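/- Let $m$ be Lebesgue measure on the Borel sets of $[0,1]$. A map $T:[0,1]\to[0,1]$ is non-singular if it is measurable and $T_\star m\ll m$; its transfer operator $P_T:L^1(m)\to L^1(m)$ is defined by $\int (P_Tf)\,g\,dm=\int f\cdot (g\circ T)\,dm$ for all $f\in L^1(m)$, $g\in L^\infty(m)$. For $f\in L^1(m)$ let $\mathrm V f$ be the infimum of the total variations over $[0,1]$ of the functions equal to $f$ $m$-a.e., let $\mathrm{BV}=\{f\in L^1(m):\mathrm Vf<\infty\}$ and $\|f\|_{\mathrm{BV}}=\mathrm Vf+\|f\|_{L^1_m}$. Let $\mathcal C$ be a class of non-singular maps of $[0,1]$ and $\mathcal P=\{P_T:T\in\mathcal C\}$. Suppose that the following conditions hold. $(D_r)$: every $P\in\mathcal P$ leaves $\mathrm{BV}$ invariant, and for some integer $r\ge1$ and constants $0<\rho_r<1$, $M_0,C_r>0$ one has $\|Pf\|_{\mathrm{BV}}\le M_0\|f\|_{\mathrm{BV}}$ and $\|P_r\cdots P_1f\|_{\mathrm{BV}}\le\rho_r\|f\|_{\mathrm{BV}}+C_r\|f\|_{L^1_m}$ for all $P,P_1,\dots,P_r\in\mathcal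 P$ and $f\in\mathrm{BV}$. (Dec): there are $\theta<1$ and $K>0$ such that $\|P_l\cdots P_1f\|_{\mathrm{BV}}\le K\theta^l\|f\|_{\mathrm{BV}}$ for all $l\ge1$, all $P_1,\dots,P_l\in\mathcal P$ and all $f\in\mathrm{BV}$ with $\int f\,dm=0$. Let $(T_n)_{n\ge1}$ be a sequence of maps in $\mathcal C$, and put $T_1^0=\mathrm{id}$, $T_1^n=T_n\circ\cdots\circ T_1$. Suppose moreover that the following condition holds. (Min): there is $\delta>0$ such that $P_{T_1^n}\mathbf 1\ge\delta$ $m$-a.e. for all $n\ge1$. For $n\ge1$ and $x\in[0,1]$ let $\mathcal E_n(x)=\frac1n\sum_{k=0}^{n-1}\delta_{T_1^kx}$ and $m_n=\frac1n\sum_{k=0}^{n-1}(T_1^k)_\star m$, and for probability measures $\mu_1,\mu_2$ on $[0,1]$ let $\kappa(\mu_1,\mu_2)=\int_0^1|\mu_1([0,t])-\mu_2([0,t])|\,dt$ be their Kantorovich distance. Then there exists $C>0$ such that for all $t>0$ and all $n\ge1$ $$m\Big(\Big\{x\in[0,1]:\kappa(\mathcal E_n(x),m_n)>\frac{t}{\sqrt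 n}\Big\}\Big)\le 2e^{-Ct^2}.$$ -/

import Mathlib

open MeasureTheory
open scoped unitInterval ENNReal

namespace SeqDyn

noncomputable section

/-- The space `L¹(m)`, with `m` the Lebesgue measure on `X = [0,1]`. -/
abbrev L1 : Type := Lp ℝ 1 (volume : Measure I)

/-- A class of non-singular transformations of `([0,1], m)`: every `T` in the class is measurable
and satisfies `T_* m ≪ m`. -/
def NonsingularClass (𝒞 : Set (I → I)) : Prop :=
  ∀ T ∈ 𝒞, Measure.QuasiMeasurePreserving T (volume : Measure I) volume

/-- The transfer operator of `T`: `P_T f` is the Radon-Nikodym derivative with respect to `m` of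
the image under `T` of the signed measure `f dm`. -/
def transferOp (T : I → I) (f : L1) : L1 :=
  (SignedMeasure.integrable_rnDeriv
    (((volume : Measure I).withDensityᵥ f).map T) (volume : Measure I)).toL1 _

/-- `P_T f` is characterised by `∫_A P_T f dm = ∫_{T⁻¹ A} f dm` for all Borel sets `A`. -/
theorem setIntegral_transferOp {T : I → I}
    (hT : Measure.QuasiMeasurePreserving T (volume : Measure I) volume) (f : L1)
    {A : Set I} (hA : MeasurableSet A) :
    ∫ x in A, transferOp T f x = ∫ x in T ⁻¹' A, f x := by
  have hf : Integrable (f : I → ℝ) (volume : Measure I) := L1.integrable_coeFn f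
  set s : SignedMeasure I := ((volume : Measure I).withDensityᵥ f).map T with hs
  have hsA : ∀ B : Set I, MeasurableSet B → s B = ∫ x in T ⁻¹' B, f x := by
    intro B hB
    rw [hs, VectorMeasure.map_apply _ hT.measurable hB,
      withDensityᵥ_apply hf (hT.measurable hB)]
  have hac : s ≪ᵥ (volume : Measure I).toENNRealVectorMeasure := by
    refine VectorMeasure.AbsolutelyContinuous.mk fun B hB h0 => ?_
    rw [Measure.toENNRealVectorMeasure_apply_measurable hB] at h0
    rw [hsA B hB]
    exact setIntegral_measure_zero _ (hT.preimage_null h0)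
  have hrn := (SignedMeasure.absolutelyContinuous_iff_withDensityᵥ_rnDeriv_eq s volume).1 hac
  have h1 : ∫ x in A, transferOp T f x = ∫ x in A, s.rnDeriv volume x :=
    setIntegral_congr_ae hA ((Integrable.coeFn_toL1 _).mono fun x hx _ => hx)
  rw [h1, ← hsA A hA, ← withDensityᵥ_apply (SignedMeasure.integrable_rnDeriv s volume) hA, hrn]

/-- `V f`, the infimum of the total variations on `[0,1]` of the representatives of `f`. -/
def essVar (f : L1) : ℝ≥0∞ :=
  ⨅ (g : I → ℝ) (_ : g =ᵐ[volume] f), eVariationOn g Set.univ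

/-- `f` belongs to the space `BV`. -/
def IsBV (f : L1) : Prop := essVar f ≠ ∞

/-- The norm `‖f‖_BV = V f + ‖f‖_{L¹}` of a function `f` in `BV`. -/
def bvNorm (f : L1) : ℝ := (essVar f).toReal + ‖f‖

/-- `P_l ⋯ P_1 f`, for the tuple of operators `[P_1, …, P_l]`. -/
def applyOps (Ps : List (L1 → L1)) (f : L1) : L1 := Ps.foldl (fun g P => P g) f

/-- Condition (H3) with the integer `r ≥ 1`, for a set `𝓟` of operators on `L¹(m)` leaving `BV`
invariant. -/
def H3 (r : ℕ) (𝓟 : Set (L1 → L1)) : Prop :=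
  1 ≤ r ∧
  (∀ P ∈ 𝓟, ∀ f : L1, IsBV f → IsBV (P f)) ∧
  ∃ ρ M₀ C : ℝ, 0 < ρ ∧ ρ < 1 ∧ 0 < M₀ ∧ 0 < C ∧
    (∀ P ∈ 𝓟, ∀ f : L1, IsBV f → bvNorm (P f) ≤ M₀ * bvNorm f) ∧
    (∀ Ps : List (L1 → L1), Ps.length = r → (∀ P ∈ Ps, P ∈ 𝓟) →
      ∀ f : L1, IsBV f → bvNorm (applyOps Ps f) ≤ ρ * bvNorm f + C * ‖f‖)

/-- The decorrelation property of a set `𝓟` of operators, on the space of functions in `BV` with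
zero average. -/
def Decorrelation (𝓟 : Set (L1 → L1)) : Prop :=
  ∃ θ K : ℝ, θ < 1 ∧ 0 < K ∧
    ∀ l : ℕ, 1 ≤ l → ∀ Ps : List (L1 → L1), Ps.length = l → (∀ P ∈ Ps, P ∈ 𝓟) →
      ∀ f : L1, IsBV f → ∫ x, f x = 0 →
        IsBV (applyOps Ps f) ∧ bvNorm (applyOps Ps f) ≤ K * θ ^ l * bvNorm f

/-- Condition `(D_r)` for a class of maps. -/
def CondD (r : ℕ) (𝒞 : Set (I → I)) : Prop := H3 r (transferOp '' 𝒞)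

/-- Condition (Dec) for a class of maps. -/
def CondDec (𝒞 : Set (I → I)) : Prop := Decorrelation (transferOp '' 𝒞)

/-- `T_1^k = T_k ∘ ⋯ ∘ T_1`, with `T_1^0 = id`. The term `T 0` is not used. -/
def seqComp (T : ℕ → I → I) : ℕ → I → I
  | 0 => id
  | k + 1 => T (k + 1) ∘ seqComp T k

/-- Condition (Min): there is `δ > 0` such that `P_1^n 𝟙 ≥ δ` for all `n ≥ 1`. -/
def CondMin (T : ℕ → I → I) : Prop :=
  ∃ δ : ℝ, 0 < δ ∧ ∀ n : ℕ, 1 ≤ n →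
    ∀ᵐ x : I, δ ≤ transferOp (seqComp T n) (Lp.const 1 (volume : Measure I) (1 : ℝ)) x

/-- The empirical measure `(1/n) ∑_{k<n} δ_{T_1^k x}`. -/
def empiricalMeasure (T : ℕ → I → I) (n : ℕ) (x : I) : Measure I :=
  (n : ℝ≥0∞)⁻¹ • ∑ k ∈ Finset.range n, Measure.dirac (seqComp T k x)

/-- The measure `m_n = (1/n) ∑_{k<n} (T_1^k)_* m`. -/
def meanMeasure (T : ℕ → I → I) (n : ℕ) : Measure I :=
  (n : ℝ≥0∞)⁻¹ • ∑ k ∈ Finset.range n, (volume : Measure I).map (seqComp T k)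

/-- The Kantorovich distance `∫_0^1 |F_{μ₁}(t) - F_{μ₂}(t)| dt` of two probability measures on
`[0,1]`, where `F_μ(t) = μ([0,t])`. -/
def kantorovich (μ₁ μ₂ : Measure I) : ℝ :=
  ∫ t : I, |μ₁.real (Set.Iic t) - μ₂.real (Set.Iic t)|

end

end SeqDyn

/-!
Write `g_k` for the density of the image of `m` under `T_1^k`. The functions
`P_T 𝟙 - 𝟙` have mean zero and are bounded in `BV`, so (Dec) bounds the `g_k` in `BV`; by (Min) they
are also bounded below, so the normalised transfer operators `F ↦ P_{k+1} (g_k F) / g_{k+1}` are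
defined. These compute conditional expectations with respect to the decreasing σ-algebras generated
by the maps `T_1^k`. For a threshold `s`, let `φ_k` be the
indicator of `[0,s]`, centred for the image measure. Since `φ_k g_k` is bounded in `BV` and has mean
zero, (Dec) makes the sums of its images under the transfer operators bounded, hence
`∑_{k<n} φ_k ∘ T_1^k` is a sum of uniformly bounded reverse martingale differences plus a bounded
remainder. By Azuma–Hoeffding it is sub-Gaussian with variance proxy `O(n)`, uniformly in `s`.
Finally `n κ(E_n, m_n)` is the average over `s` of the absolute values of these sums, so by Jensen's
inequality its exponential moments are bounded by their average over `s`, and Markov's inequality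
applies: no supremum over `s` is ever needed.
-/

namespace SeqDyn

open ProbabilityTheory
open scoped NNReal

noncomputable section

section Azuma

variable {Ω : Type*} {m mΩ : MeasurableSpace Ω} [StandardBorelSpace Ω] {μ : Measure Ω}
  {Y : Ω → ℝ} {a b : ℝ}

theorem hasCondSubgaussianMGF_of_mem_Icc_of_condExp_eq_zero [IsFiniteMeasure μ] (hm : m ≤ mΩ)
    (hY : AEMeasurable Y μ) (hb : ∀ᵐ ω ∂μ, Y ω ∈ Set.Icc a b) (hc : μ[Y | m] =ᵐ[μ] 0) :
    HasCondSubgaussianMGF m hm Y ((‖b - a‖₊ / 2) ^ 2) μ where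
  integrable_exp_mul t := by
    rw [condExpKernel_comp_trim]
    exact integrable_exp_mul_of_mem_Icc hY hb
  mgf_le := by
    have hκ := condExpKernel_comp_trim (μ := μ) hm
    have hmean : ∀ᵐ ω ∂μ.trim hm, ∫ y, Y y ∂condExpKernel μ m ω = 0 := by
      filter_upwards [
        condExp_ae_eq_trim_integral_condExpKernel hm (Integrable.of_mem_Icc a b hY hb),
        StronglyMeasurable.ae_eq_trim_of_stronglyMeasurable hm stronglyMeasurable_condExp
          stronglyMeasurable_zero hc] with ω h₁ h₂
      rw [← h₁, h₂, Pi.zero_apply]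
    have hmeas : ∀ᵐ ω ∂μ.trim hm, Y =ᵐ[condExpKernel μ m ω] hY.mk Y :=
      Measure.ae_ae_of_ae_comp (hκ.symm ▸ hY.ae_eq_mk)
    filter_upwards [hmean, hmeas, Measure.ae_ae_of_ae_comp (hκ.symm ▸ hb)] with ω h₀ h₁ h₂
    exact (hasSubgaussianMGF_of_mem_Icc_of_integral_eq_zero
      (hY.measurable_mk.aemeasurable.congr h₁.symm) h₂ h₀).mgf_le

/-- Azuma–Hoeffding for reverse martingales: the filtration `𝓖` decreases. -/
theorem hasSubgaussianMGF_sum_add_of_antitone [IsFiniteMeasure μ] {𝓖 : ℕ → MeasurableSpace Ω}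
    (h𝓖 : Antitone 𝓖) (hle : ∀ k, 𝓖 k ≤ mΩ) {Y : ℕ → Ω → ℝ} {c : ℕ → ℝ≥0}
    (hY : ∀ k, Measurable[𝓖 k] (Y k))
    (hcond : ∀ k, HasCondSubgaussianMGF (𝓖 (k + 1)) (hle (k + 1)) (Y k) (c k) μ)
    (n : ℕ) {R : Ω → ℝ} {cR : ℝ≥0} (hR : Measurable[𝓖 n] R) (hRsub : HasSubgaussianMGF R cR μ) :
    HasSubgaussianMGF (∑ k ∈ Finset.range n, Y k + R) (∑ k ∈ Finset.range n, c k + cR) μ := by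
  induction n generalizing R cR with
  | zero => simpa using hRsub
  | succ n ih =>
    have hadd := (hRsub.trim (hle (n + 1)) hR).add_of_hasCondSubgaussianMGF (hle (n + 1)) (hcond n)
    have hmeas : Measurable[𝓖 n] (R + Y n) := (hR.mono (h𝓖 n.le_succ) le_rfl).add (hY n)
    have := ih hmeas hadd
    rwa [← add_assoc, add_right_comm _ R, ← Finset.sum_range_succ, ← add_assoc,
      add_right_comm _ cR, ← Finset.sum_range_succ] at this

end Azuma

section IntegralAbs

variable {Ω Θ : Type*} [MeasurableSpace Ω] [MeasurableSpace Θ] {μ : Measure Ω}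
  {ν : Measure Θ} {Z : Ω → Θ → ℝ} {c : ℝ≥0}

theorem hasSubgaussianMGF_mono {X : Ω → ℝ} {d : ℝ≥0} (hX : HasSubgaussianMGF X c μ) (hcd : c ≤ d) :
    HasSubgaussianMGF X d μ where
  integrable_exp_mul := hX.integrable_exp_mul
  mgf_le t := (hX.mgf_le t).trans (by gcongr)

theorem mgf_abs_le {X : Ω → ℝ} (hX : HasSubgaussianMGF X c μ) (l : ℝ) :
    mgf (fun x => |X x|) μ l ≤ 2 * Real.exp (c * l ^ 2 / 2) := by
  have hpoint (x : Ω) : Real.exp (l * |X x|) ≤ Real.exp (l * X x) + Real.exp (-l * X x) := by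
    rcases abs_cases (X x) with ⟨h, -⟩ | ⟨h, -⟩ <;> rw [h]
    · exact le_add_of_nonneg_right (Real.exp_nonneg _)
    · rw [mul_neg, neg_mul]
      exact le_add_of_nonneg_left (Real.exp_nonneg _)
  calc mgf (fun x => |X x|) μ l ≤ ∫ x, Real.exp (l * X x) + Real.exp (-l * X x) ∂μ :=
        integral_mono_of_nonneg (.of_forall fun x => Real.exp_nonneg _)
          ((hX.integrable_exp_mul l).add (hX.integrable_exp_mul (-l))) (.of_forall hpoint)
    _ = mgf X μ l + mgf X μ (-l) :=
        integral_add (hX.integrable_exp_mul l) (hX.integrable_exp_mul (-l))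
    _ ≤ Real.exp (c * l ^ 2 / 2) + Real.exp (c * (-l) ^ 2 / 2) :=
        add_le_add (hX.mgf_le l) (hX.mgf_le (-l))
    _ = 2 * Real.exp (c * l ^ 2 / 2) := by rw [neg_sq, two_mul]

theorem integrable_uncurry_exp_mul_abs [SFinite μ] [IsFiniteMeasure ν]
    (hZ : Measurable (Function.uncurry Z))
    (hsub : ∀ θ, HasSubgaussianMGF (fun x => Z x θ) c μ) (l : ℝ) :
    Integrable (fun p : Ω × Θ => Real.exp (l * |Z p.1 p.2|)) (μ.prod ν) := by
  have hmeas : Measurable fun p : Ω × Θ => Real.exp (l * |Z p.1 p.2|) :=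
    ((measurable_norm.comp hZ).const_mul l).exp
  refine (integrable_prod_iff' hmeas.aestronglyMeasurable).2
    ⟨.of_forall fun θ => integrable_exp_mul_abs ((hsub θ).integrable_exp_mul l)
      ((hsub θ).integrable_exp_mul (-l)), ?_⟩
  refine .of_bound hmeas.norm.stronglyMeasurable.integral_prod_left.aestronglyMeasurable
    (2 * Real.exp (c * l ^ 2 / 2)) (.of_forall fun θ => ?_)
  rw [Real.norm_of_nonneg (integral_nonneg fun _ => norm_nonneg _)]
  simp only [Real.norm_eq_abs, Real.abs_exp]
  exact mgf_abs_le (hsub θ) l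

theorem exp_mul_integral_abs_le [SFinite μ] [IsProbabilityMeasure ν]
    (hZ : Measurable (Function.uncurry Z))
    (hsub : ∀ θ, HasSubgaussianMGF (fun x => Z x θ) c μ) (l : ℝ) :
    ∀ᵐ x ∂μ, Real.exp (l * ∫ θ, |Z x θ| ∂ν) ≤ ∫ θ, Real.exp (l * |Z x θ|) ∂ν := by
  filter_upwards [(integrable_uncurry_exp_mul_abs (ν := ν) hZ hsub l).prod_right_ae,
    (integrable_uncurry_exp_mul_abs (ν := ν) hZ hsub 1).prod_right_ae] with x hl h1
  have hZx : Integrable (fun θ => |Z x θ|) ν :=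
    h1.mono' (measurable_norm.comp hZ.of_uncurry_left).aestronglyMeasurable
      (.of_forall fun θ => by
        rw [Real.norm_eq_abs, abs_abs, one_mul]
        linarith [Real.add_one_le_exp |Z x θ|])
  rw [← integral_const_mul]
  exact convexOn_exp.map_integral_le Real.continuous_exp.continuousOn isClosed_univ
    (.of_forall fun _ => Set.mem_univ _) (hZx.const_mul l) hl

theorem integrable_exp_mul_integral_abs [SFinite μ] [IsProbabilityMeasure ν]
    (hZ : Measurable (Function.uncurry Z))
    (hsub : ∀ θ, HasSubgaussianMGF (fun x => Z x θ) c μ) (l : ℝ) :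
    Integrable (fun x => Real.exp (l * ∫ θ, |Z x θ| ∂ν)) μ := by
  have hmeas : Measurable fun x => ∫ θ, |Z x θ| ∂ν :=
    (measurable_norm.comp hZ).stronglyMeasurable.integral_prod_right'.measurable
  exact (integrable_uncurry_exp_mul_abs hZ hsub l).integral_prod_left.mono'
    (hmeas.const_mul l).exp.aestronglyMeasurable
    ((exp_mul_integral_abs_le hZ hsub l).mono fun x hx => by rwa [Real.norm_eq_abs, Real.abs_exp])

theorem mgf_integral_abs_le [SFinite μ] [IsProbabilityMeasure ν]
    (hZ : Measurable (Function.uncurry Z))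
    (hsub : ∀ θ, HasSubgaussianMGF (fun x => Z x θ) c μ) (l : ℝ) :
    mgf (fun x => ∫ θ, |Z x θ| ∂ν) μ l ≤ 2 * Real.exp (c * l ^ 2 / 2) := by
  have hint := integrable_uncurry_exp_mul_abs (ν := ν) hZ hsub l
  calc mgf (fun x => ∫ θ, |Z x θ| ∂ν) μ l
      ≤ ∫ x, ∫ θ, Real.exp (l * |Z x θ|) ∂ν ∂μ :=
        integral_mono_ae (integrable_exp_mul_integral_abs hZ hsub l) hint.integral_prod_left
          (exp_mul_integral_abs_le hZ hsub l)
    _ = ∫ θ, mgf (fun x => |Z x θ|) μ l ∂ν := integral_integral_swap hint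
    _ ≤ ∫ _, 2 * Real.exp (c * l ^ 2 / 2) ∂ν :=
        integral_mono hint.integral_prod_right (integrable_const _)
          fun θ => mgf_abs_le (hsub θ) l
    _ = 2 * Real.exp (c * l ^ 2 / 2) := by
        rw [integral_const, probReal_univ, one_smul]

theorem measureReal_ge_integral_abs_le [IsFiniteMeasure μ] [IsProbabilityMeasure ν]
    (hZ : Measurable (Function.uncurry Z))
    (hsub : ∀ θ, HasSubgaussianMGF (fun x => Z x θ) c μ) {ε : ℝ} (hε : 0 ≤ ε) :
    μ.real {x | ε ≤ ∫ θ, |Z x θ| ∂ν} ≤ 2 * Real.exp (-ε ^ 2 / (2 * c)) := by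
  have hmgf := mgf_integral_abs_le (ν := ν) hZ hsub (ε / c)
  refine (measure_ge_le_exp_mul_mgf ε (by positivity)
    (integrable_exp_mul_integral_abs hZ hsub (ε / c))).trans ?_
  calc Real.exp (-(ε / c) * ε) * mgf (fun x => ∫ θ, |Z x θ| ∂ν) μ (ε / c)
      ≤ Real.exp (-(ε / c) * ε) * (2 * Real.exp (c * (ε / c) ^ 2 / 2)) := by gcongr
    _ = 2 * Real.exp (-ε ^ 2 / (2 * c)) := by
      rw [mul_left_comm, ← Real.exp_add]
      rcases eq_or_ne c 0 with rfl | hc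
      · simp
      · congr 2
        field_simp
        ring

end IntegralAbs

section Variation

variable {α : Type*} [LinearOrder α] {s : Set α}

theorem eVariationOn_add_le {E : Type*} [SeminormedAddCommGroup E] (f g : α → E) (s : Set α) :
    eVariationOn (f + g) s ≤ eVariationOn f s + eVariationOn g s := by
  refine iSup_le fun p => ?_
  calc ∑ i ∈ Finset.range p.1, edist ((f + g) (p.2.1 (i + 1))) ((f + g) (p.2.1 i))
      ≤ ∑ i ∈ Finset.range p.1, (edist (f (p.2.1 (i + 1))) (f (p.2.1 i)) +
          edist (g (p.2.1 (i + 1))) (g (p.2.1 i))) :=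
        Finset.sum_le_sum fun i _ => edist_add_add_le _ _ _ _
    _ ≤ eVariationOn f s + eVariationOn g s := by
        rw [Finset.sum_add_distrib]
        exact add_le_add (eVariationOn.sum_le p.2.2.1 p.2.2.2) (eVariationOn.sum_le p.2.2.1 p.2.2.2)

theorem edist_mul_mul_le {R : Type*} [NonUnitalSeminormedRing R] (a b c d : R) :
    edist (a * b) (c * d) ≤ ‖a‖ₑ * edist b d + edist a c * ‖d‖ₑ := by
  have henorm (x y : R) : ‖x * y‖ₑ ≤ ‖x‖ₑ * ‖y‖ₑ := by
    simpa only [enorm_eq_nnnorm, ← ENNReal.coe_mul, ENNReal.coe_le_coe] using nnnorm_mul_le x y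
  calc edist (a * b) (c * d) ≤ edist (a * b) (a * d) + edist (a * d) (c * d) := edist_triangle _ _ _
    _ = ‖a * (b - d)‖ₑ + ‖(a - c) * d‖ₑ := by
        simp only [edist_eq_enorm_sub, mul_sub, sub_mul]
    _ ≤ ‖a‖ₑ * edist b d + edist a c * ‖d‖ₑ := by
        simp only [edist_eq_enorm_sub]
        exact add_le_add (henorm _ _) (henorm _ _)

theorem eVariationOn_mul_le {R : Type*} [NonUnitalSeminormedRing R] {f g : α → R} {A B : ℝ≥0∞}
    (hf : ∀ x ∈ s, ‖f x‖ₑ ≤ A) (hg : ∀ x ∈ s, ‖g x‖ₑ ≤ B) :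
    eVariationOn (f * g) s ≤ A * eVariationOn g s + eVariationOn f s * B := by
  refine iSup_le fun ⟨n, u, hu, hus⟩ => ?_
  calc ∑ i ∈ Finset.range n, edist ((f * g) (u (i + 1))) ((f * g) (u i))
      ≤ ∑ i ∈ Finset.range n, (A * edist (g (u (i + 1))) (g (u i)) +
          edist (f (u (i + 1))) (f (u i)) * B) :=
        Finset.sum_le_sum fun i _ => (edist_mul_mul_le _ _ _ _).trans
          (add_le_add (mul_le_mul_left (hf _ (hus _)) _) (mul_le_mul_right (hg _ (hus _)) _))
    _ ≤ A * eVariationOn g s + eVariationOn f s * B := by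
        rw [Finset.sum_add_distrib, ← Finset.mul_sum, ← Finset.sum_mul]
        gcongr
        · exact eVariationOn.sum_le hu hus
        · exact eVariationOn.sum_le hu hus

theorem eVariationOn_eq_of_antitoneOn {f : α → ℝ} {a b : α} (hf : AntitoneOn f s)
    (ha : a ∈ s) (hb : b ∈ s) :
    eVariationOn f (s ∩ Set.Icc a b) = ENNReal.ofReal (f a - f b) := by
  have hneg :
      eVariationOn (fun x => -f x) (s ∩ Set.Icc a b) = eVariationOn f (s ∩ Set.Icc a b) := by
    simp only [eVariationOn, edist_neg_neg]
  rw [← hneg, hf.neg.eVariationOn_eq ha hb, neg_sub_neg]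

theorem enorm_le_eVariationOn_add_lintegral {E : Type*} [SeminormedAddCommGroup E]
    [MeasurableSpace α] (μ : Measure α) [IsProbabilityMeasure μ] {f : α → E}
    (hf : AEStronglyMeasurable f μ) (x : α) :
    ‖f x‖ₑ ≤ eVariationOn f Set.univ + ∫⁻ y, ‖f y‖ₑ ∂μ := by
  obtain ⟨y, hy⟩ := exists_le_lintegral hf.enorm
  calc ‖f x‖ₑ ≤ edist (f x) (f y) + ‖f y‖ₑ := by
        simpa only [edist_zero_right] using edist_triangle (f x) (f y) 0
    _ ≤ eVariationOn f Set.univ + ∫⁻ y, ‖f y‖ₑ ∂μ :=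
        add_le_add (eVariationOn.edist_le f (Set.mem_univ x) (Set.mem_univ y)) hy

end Variation

section BVNorm

/-- The norm `‖f‖_BV = V f + ‖f‖_{L¹}` as an extended nonnegative number, equal to `∞` off `BV`,
so that it is subadditive without side conditions. -/
def ebvNorm (f : L1) : ℝ≥0∞ := essVar f + ‖f‖ₑ

theorem ebvNorm_ne_top_iff {f : L1} : ebvNorm f ≠ ∞ ↔ IsBV f := by
  rw [ebvNorm, ENNReal.add_ne_top, IsBV, and_iff_left enorm_ne_top]

theorem IsBV.ofReal_bvNorm {f : L1} (hf : IsBV f) : ENNReal.ofReal (bvNorm f) = ebvNorm f := by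
  rw [bvNorm, ENNReal.ofReal_add ENNReal.toReal_nonneg (norm_nonneg f), ENNReal.ofReal_toReal hf,
    ofReal_norm, ebvNorm]

theorem enorm_eq_lintegral_of_ae_eq {f : L1} {g : I → ℝ} (hg : g =ᵐ[volume] f) :
    ‖f‖ₑ = ∫⁻ x, ‖g x‖ₑ := by
  rw [Lp.enorm_def, eLpNorm_one_eq_lintegral_enorm]
  exact lintegral_congr_ae (hg.mono fun x hx => by simp only [hx])

theorem ebvNorm_eq_iInf (f : L1) :
    ebvNorm f = ⨅ g : {g : I → ℝ // g =ᵐ[volume] f}, (eVariationOn g.1 Set.univ + ‖f‖ₑ) := by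
  rw [ebvNorm, essVar, ENNReal.iInf₂_add, iInf_subtype']

theorem ebvNorm_le {f : L1} {g : I → ℝ} (hg : g =ᵐ[volume] f) :
    ebvNorm f ≤ eVariationOn g Set.univ + ‖f‖ₑ :=
  add_le_add_left (iInf₂_le g hg) _

theorem ebvNorm_add_le (f g : L1) : ebvNorm (f + g) ≤ ebvNorm f + ebvNorm g := by
  rw [ebvNorm_eq_iInf f, ebvNorm_eq_iInf g]
  refine ENNReal.le_iInf_add_iInf fun u v => ?_
  calc ebvNorm (f + g) ≤ eVariationOn (u.1 + v.1) Set.univ + ‖f + g‖ₑ :=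
        ebvNorm_le ((u.2.add v.2).trans (Lp.coeFn_add f g).symm)
    _ ≤ (eVariationOn u.1 Set.univ + eVariationOn v.1 Set.univ) + (‖f‖ₑ + ‖g‖ₑ) :=
        add_le_add (eVariationOn_add_le _ _ _) (enorm_add_le f g)
    _ = _ := add_add_add_comm _ _ _ _

theorem ebvNorm_const_le (a : ℝ) : ebvNorm (Lp.const 1 volume a) ≤ ‖a‖ₑ := by
  have hV : eVariationOn (fun _ : I => a) Set.univ = 0 :=
    eVariationOn.constant_on (Set.subsingleton_singleton.anti
      (Set.image_subset_iff.2 fun _ _ => Set.mem_singleton a))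
  have hae : (fun _ => a) =ᵐ[volume] Lp.const 1 (volume : Measure I) a :=
    (Lp.coeFn_const 1 volume a).symm
  refine (ebvNorm_le hae).trans_eq ?_
  rw [hV, zero_add, enorm_eq_lintegral_of_ae_eq hae, lintegral_const, measure_univ, mul_one]

theorem ebvNorm_zero : ebvNorm 0 = 0 :=
  nonpos_iff_eq_zero.1 (by simpa only [map_zero, enorm_zero] using ebvNorm_const_le 0)

theorem ebvNorm_sum_le {ι : Type*} (s : Finset ι) (f : ι → L1) :
    ebvNorm (∑ i ∈ s, f i) ≤ ∑ i ∈ s, ebvNorm (f i) :=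
  Finset.le_sum_of_subadditive ebvNorm ebvNorm_zero.le ebvNorm_add_le s f

theorem enorm_le_eVariationOn_add_enorm {f : L1} {g : I → ℝ} (hg : g =ᵐ[volume] f) (x : I) :
    ‖g x‖ₑ ≤ eVariationOn g Set.univ + ‖f‖ₑ := by
  rw [enorm_eq_lintegral_of_ae_eq hg]
  exact enorm_le_eVariationOn_add_lintegral volume
    ((Lp.aestronglyMeasurable f).congr hg.symm) x

theorem enorm_le_ebvNorm (f : L1) : ∀ᵐ x : I, ‖f x‖ₑ ≤ ebvNorm f := by
  have hsup : eLpNormEssSup f volume ≤ ebvNorm f := by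
    rw [ebvNorm_eq_iInf]
    refine le_iInf fun g => eLpNormEssSup_le_of_ae_enorm_bound (g.2.mono fun x hx => ?_)
    rw [← hx]
    exact enorm_le_eVariationOn_add_enorm g.2 x
  exact ae_le_eLpNormEssSup.mono fun x hx => hx.trans hsup

theorem ebvNorm_le_mul_of_ae_eq_mul {u : I → ℝ} {f v : L1} {A B : ℝ≥0} (hA : ∀ x, ‖u x‖ₑ ≤ A)
    (hB : eVariationOn u Set.univ ≤ B) (hv : v =ᵐ[volume] u * f) :
    ebvNorm v ≤ (A + B : ℝ≥0) * ebvNorm f := by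
  have : Nonempty {g : I → ℝ // g =ᵐ[volume] f} := ⟨⟨f, ae_eq_refl _⟩⟩
  rw [ebvNorm_eq_iInf f, ENNReal.mul_iInf fun h => absurd h ENNReal.coe_ne_top]
  refine le_iInf fun ⟨g, hg⟩ => ?_
  have hvg : u * g =ᵐ[volume] v := ((ae_eq_refl u).mul hg).trans hv.symm
  have hnorm : ‖v‖ₑ ≤ A * ‖f‖ₑ := by
    rw [enorm_eq_lintegral_of_ae_eq hvg, enorm_eq_lintegral_of_ae_eq hg,
      ← lintegral_const_mul' _ _ ENNReal.coe_ne_top]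
    refine lintegral_mono fun x => ?_
    rw [Pi.mul_apply, enorm_mul]
    exact mul_le_mul_left (hA x) _
  have hvar := eVariationOn_mul_le (s := Set.univ) (fun x _ => hA x)
    (fun x _ => enorm_le_eVariationOn_add_enorm hg x)
  calc ebvNorm v ≤ eVariationOn (u * g) Set.univ + ‖v‖ₑ := ebvNorm_le hvg
    _ ≤ (A * eVariationOn g Set.univ + B * (eVariationOn g Set.univ + ‖f‖ₑ)) + A * ‖f‖ₑ :=
        add_le_add (hvar.trans (add_le_add_right (mul_le_mul_left hB _) _)) hnorm
    _ = (A + B : ℝ≥0) * (eVariationOn g Set.univ + ‖f‖ₑ) := by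
        push_cast
        ring

end BVNorm

section TransferOperator

/-- A non-singular transformation of `([0,1], m)`. -/
abbrev Nonsingular (S : I → I) : Prop :=
  Measure.QuasiMeasurePreserving S (volume : Measure I) volume

variable {S S' : I → I}

theorem eq_of_forall_setIntegral_eq {f g : L1}
    (h : ∀ A, MeasurableSet A → ∫ x in A, f x = ∫ x in A, g x) : f = g :=
  Lp.ext (Integrable.ae_eq_of_forall_setIntegral_eq f g (L1.integrable_coeFn f)
    (L1.integrable_coeFn g) fun A hA _ => h A hA)

theorem transferOp_id (f : L1) : transferOp id f = f :=
  eq_of_forall_setIntegral_eq fun _ hA => setIntegral_transferOp (.id volume) f hA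

theorem transferOp_comp (hS' : Nonsingular S') (hS : Nonsingular S) (f : L1) :
    transferOp (S' ∘ S) f = transferOp S' (transferOp S f) :=
  eq_of_forall_setIntegral_eq fun A hA => by
    rw [setIntegral_transferOp (hS'.comp hS) f hA, setIntegral_transferOp hS' _ hA,
      setIntegral_transferOp hS f (hS'.measurable hA), Set.preimage_comp]

theorem setIntegral_add_L1 (f g : L1) (A : Set I) :
    ∫ x in A, (f + g) x = (∫ x in A, f x) + ∫ x in A, g x := by
  rw [← integral_add' (L1.integrable_coeFn f).integrableOn (L1.integrable_coeFn g).integrableOn]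
  exact integral_congr_ae (ae_restrict_of_ae (Lp.coeFn_add f g))

theorem transferOp_add (hS : Nonsingular S) (f g : L1) :
    transferOp S (f + g) = transferOp S f + transferOp S g :=
  eq_of_forall_setIntegral_eq fun A hA => by
    simp only [setIntegral_add_L1, setIntegral_transferOp hS _ hA]

theorem integral_transferOp (hS : Nonsingular S) (f : L1) : ∫ x, transferOp S f x = ∫ x, f x := by
  simpa only [setIntegral_univ, Set.preimage_univ] using
    setIntegral_transferOp hS f MeasurableSet.univ

/-- The density `P_S 𝟙` of the image `S_* m` with respect to `m`. -/
def density (S : I → I) : L1 := transferOp S (Lp.const 1 volume 1)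

theorem density_id : density id = Lp.const 1 volume 1 := transferOp_id _

theorem setIntegral_density (hS : Nonsingular S) {A : Set I} (hA : MeasurableSet A) :
    ∫ x in A, density S x = (volume.map S).real A := by
  rw [density, setIntegral_transferOp hS _ hA, map_measureReal_apply hS.measurable hA,
    ← setIntegral_one_eq_measureReal]
  exact integral_congr_ae (ae_restrict_of_ae (Lp.coeFn_const 1 volume 1))

theorem density_nonneg (hS : Nonsingular S) : ∀ᵐ x : I, 0 ≤ density S x :=
  ae_nonneg_of_forall_setIntegral_nonneg (L1.integrable_coeFn _) fun A hA _ => by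
    rw [setIntegral_density hS hA]
    exact measureReal_nonneg

theorem map_eq_withDensity_density (hS : Nonsingular S) :
    volume.map S = volume.withDensity fun x => ENNReal.ofReal (density S x) := by
  have : IsProbabilityMeasure (volume.map S) :=
    Measure.isProbabilityMeasure_map hS.measurable.aemeasurable
  refine Measure.ext fun A hA => ?_
  rw [withDensity_apply _ hA, ← ofReal_integral_eq_lintegral_ofReal
    (L1.integrable_coeFn _).integrableOn (ae_restrict_of_ae (density_nonneg hS)),
    setIntegral_density hS hA, ofReal_measureReal]

/-- The observable `(F / P_S 𝟙) ∘ S`. When `F = P_S f` it is the conditional expectation of `f`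
given `S`. -/
def densityRatio (S : I → I) (F : L1) (x : I) : ℝ := F (S x) / density S (S x)

theorem measurable_densityRatio (S : I → I) (F : L1) :
    Measurable[MeasurableSpace.comap S inferInstance] (densityRatio S F) :=
  ((Lp.stronglyMeasurable F).measurable.div (Lp.stronglyMeasurable (density S)).measurable).comp
    (comap_measurable S)

theorem densityRatio_add (hS : Nonsingular S) (F G : L1) :
    densityRatio S (F + G) =ᵐ[volume] densityRatio S F + densityRatio S G := by
  filter_upwards [hS.ae (Lp.coeFn_add F G)] with x hx
  rw [Pi.add_apply, densityRatio, hx, Pi.add_apply, add_div, densityRatio, densityRatio]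

theorem abs_densityRatio_le (hS : Nonsingular S) {δ A : ℝ≥0} (hδ : 0 < δ)
    (hdens : ∀ᵐ x : I, δ ≤ density S x) {F : L1} (hF : ebvNorm F ≤ A) :
    ∀ᵐ x : I, |densityRatio S F x| ≤ A / δ := by
  filter_upwards [hS.ae (enorm_le_ebvNorm F), hS.ae hdens] with x hFx hx
  have hnum : |F (S x)| ≤ A := by
    exact_mod_cast enorm_le_coe.1 (hFx.trans hF)
  rw [densityRatio, abs_div, abs_of_nonneg (δ.coe_nonneg.trans hx)]
  gcongr

theorem ae_density_ne_zero {δ : ℝ≥0} (hδ : 0 < δ) (hdens : ∀ᵐ x : I, δ ≤ density S x) :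
    ∀ᵐ x : I, density S x ≠ 0 :=
  hdens.mono fun _ hx => ((NNReal.coe_pos.2 hδ).trans_le hx).ne'

theorem toReal_ofReal_density_smul_div (hS : Nonsingular S) (hpos : ∀ᵐ x : I, density S x ≠ 0)
    (F : L1) :
    (fun x => (ENNReal.ofReal (density S x)).toReal • (F x / density S x)) =ᵐ[volume] F := by
  filter_upwards [density_nonneg hS, hpos] with x hx hx0
  rw [ENNReal.toReal_ofReal hx, smul_eq_mul, mul_div_cancel₀ _ hx0]

theorem setIntegral_densityRatio (hS : Nonsingular S) (hpos : ∀ᵐ x : I, density S x ≠ 0)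
    (F : L1) {A : Set I} (hA : MeasurableSet A) :
    ∫ x in S ⁻¹' A, densityRatio S F x = ∫ x in A, F x := by
  have hmeas : Measurable fun x => F x / density S x :=
    (Lp.stronglyMeasurable F).measurable.div (Lp.stronglyMeasurable _).measurable
  calc ∫ x in S ⁻¹' A, densityRatio S F x
      = ∫ x in A, F x / density S x ∂volume.map S :=
        (setIntegral_map hA hmeas.aestronglyMeasurable hS.measurable.aemeasurable).symm
    _ = ∫ x in A, (ENNReal.ofReal (density S x)).toReal • (F x / density S x) := by
        rw [map_eq_withDensity_density hS, setIntegral_withDensity_eq_setIntegral_toReal_smul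
          (Lp.stronglyMeasurable _).measurable.ennreal_ofReal
          (.of_forall fun _ => ENNReal.ofReal_lt_top) _ hA]
    _ = ∫ x in A, F x :=
        integral_congr_ae (ae_restrict_of_ae (toReal_ofReal_density_smul_div hS hpos F))

theorem integrable_densityRatio (hS : Nonsingular S) (hpos : ∀ᵐ x : I, density S x ≠ 0) (F : L1) :
    Integrable (densityRatio S F) := by
  have hint : Integrable (fun x => F x / density S x) (volume.map S) := by
    rw [map_eq_withDensity_density hS, integrable_withDensity_iff_integrable_smul'
      (Lp.stronglyMeasurable _).measurable.ennreal_ofReal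
      (.of_forall fun _ => ENNReal.ofReal_lt_top)]
    exact (L1.integrable_coeFn F).congr (toReal_ofReal_density_smul_div hS hpos F).symm
  exact hint.comp_measurable hS.measurable

theorem condExp_densityRatio (hS : Nonsingular S) (hS' : Nonsingular S')
    (hpos : ∀ᵐ x : I, density S x ≠ 0) (hpos' : ∀ᵐ x : I, density (S' ∘ S) x ≠ 0) (F : L1) :
    volume[densityRatio S F | MeasurableSpace.comap (S' ∘ S) inferInstance]
      =ᵐ[volume] densityRatio (S' ∘ S) (transferOp S' F) := by
  have hSS' := hS'.comp hS
  refine (ae_eq_condExp_of_forall_setIntegral_eq hSS'.measurable.comap_le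
    (integrable_densityRatio hS hpos F)
    (fun _ _ _ => (integrable_densityRatio hSS' hpos' _).integrableOn) ?_
    (measurable_densityRatio _ _).aestronglyMeasurable).symm
  rintro _ ⟨A, hA, rfl⟩ -
  rw [setIntegral_densityRatio hSS' hpos' _ hA, setIntegral_transferOp hS' F hA,
    Set.preimage_comp, setIntegral_densityRatio hS hpos F (hS'.measurable hA)]

end TransferOperator

section PushedSums

variable {𝒞 : Set (I → I)} {T : ℕ → I → I}

theorem integral_add_L1 (f g : L1) : ∫ x, (f + g) x = (∫ x, f x) + ∫ x, g x := by
  simpa only [setIntegral_univ] using setIntegral_add_L1 f g Set.univ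

theorem nonsingular_seqComp (hT : ∀ n, 1 ≤ n → Nonsingular (T n)) (n : ℕ) :
    Nonsingular (seqComp T n) := by
  induction n with
  | zero => exact .id volume
  | succ n ih => exact (hT (n + 1) n.succ_pos).comp ih

/-- The sum `∑_{j<p} P_p ⋯ P_{j+1} f_j` of the functions `f_0, …, f_{p-1}`, each pushed forward to
time `p`. -/
def pushSum (T : ℕ → I → I) (f : ℕ → L1) : ℕ → L1
  | 0 => 0
  | p + 1 => transferOp (T (p + 1)) (pushSum T f p + f p)

theorem pushSum_eq_sum (hT : ∀ n, 1 ≤ n → Nonsingular (T n)) (f : ℕ → L1) (p : ℕ) :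
    pushSum T f p = ∑ j ∈ Finset.range p,
      applyOps ((List.range' (j + 1) (p - j)).map fun i => transferOp (T i)) (f j) := by
  induction p with
  | zero => rfl
  | succ p ih =>
    have hsum : pushSum T f p + f p = ∑ j ∈ Finset.range (p + 1),
        applyOps ((List.range' (j + 1) (p - j)).map fun i => transferOp (T i)) (f j) := by
      rw [Finset.sum_range_succ, ← ih, Nat.sub_self]
      rfl
    rw [pushSum, hsum]
    refine (map_sum (AddMonoidHom.mk' _ (transferOp_add (hT (p + 1) p.succ_pos))) _ _).trans
      (Finset.sum_congr rfl fun j hj => ?_)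
    have hjp : j ≤ p := Finset.mem_range_succ_iff.1 hj
    rw [Nat.succ_sub hjp, List.range'_1_concat, show j + 1 + (p - j) = p + 1 by lia,
      List.map_append, applyOps, applyOps, List.foldl_append]
    rfl

theorem integral_pushSum (hT : ∀ n, 1 ≤ n → Nonsingular (T n)) {f : ℕ → L1}
    (hf : ∀ k, ∫ x, f k x = 0) (p : ℕ) : ∫ x, pushSum T f p x = 0 := by
  induction p with
  | zero => simp [pushSum]
  | succ p ih =>
    rw [pushSum, integral_transferOp (hT (p + 1) p.succ_pos), integral_add_L1, ih, hf, add_zero]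

theorem CondDec.exists_ebvNorm_applyOps_le (hDec : CondDec 𝒞) :
    ∃ θ K : ℝ≥0, θ < 1 ∧ ∀ Ps : List (L1 → L1), Ps ≠ [] → (∀ P ∈ Ps, P ∈ transferOp '' 𝒞) →
      ∀ f : L1, IsBV f → ∫ x, f x = 0 →
        ebvNorm (applyOps Ps f) ≤ (K * θ ^ Ps.length : ℝ≥0) * ebvNorm f := by
  obtain ⟨θ, K, hθ, hK, hdec⟩ := hDec
  have hbv (f : L1) : 0 ≤ bvNorm f := add_nonneg ENNReal.toReal_nonneg (norm_nonneg f)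
  refine ⟨θ.toNNReal, K.toNNReal, Real.toNNReal_lt_one.2 hθ, fun Ps hne hPs f hf hf0 => ?_⟩
  obtain ⟨hPf, hle⟩ := hdec _ (List.length_pos_iff.2 hne) Ps rfl hPs f hf hf0
  -- A negative `θ` is only possible if `bvNorm f = 0`, by (Dec) with `l = 1`.
  have hpow : θ ^ Ps.length * bvNorm f ≤ max θ 0 ^ Ps.length * bvNorm f := by
    rcases le_or_gt 0 θ with h | h
    · rw [max_eq_left h]
    · have h1 := (hdec 1 le_rfl [Ps.head hne] rfl
        (by simpa using hPs _ (List.head_mem hne)) f hf hf0).2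
      have : bvNorm f = 0 := by
        have := (hbv _).trans h1
        rw [pow_one] at this
        nlinarith [hbv f, mul_pos hK (neg_pos.2 h)]
      rw [this, mul_zero, mul_zero]
  calc ebvNorm (applyOps Ps f) = ENNReal.ofReal (bvNorm (applyOps Ps f)) := hPf.ofReal_bvNorm.symm
    _ ≤ ENNReal.ofReal ((K.toNNReal * θ.toNNReal ^ Ps.length : ℝ≥0) * bvNorm f) := by
        refine ENNReal.ofReal_le_ofReal (hle.trans ?_)
        push_cast
        rw [Real.coe_toNNReal _ hK.le, Real.coe_toNNReal', mul_assoc, mul_assoc]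
        exact mul_le_mul_of_nonneg_left hpow hK.le
    _ = (K.toNNReal * θ.toNNReal ^ Ps.length : ℝ≥0) * ebvNorm f := by
        rw [ENNReal.ofReal_mul NNReal.zero_le_coe, ENNReal.ofReal_coe_nnreal, hf.ofReal_bvNorm]

theorem sum_pow_sub_le_tsum {θ : ℝ≥0} (hθ : θ < 1) (p : ℕ) :
    ∑ j ∈ Finset.range p, θ ^ (p - j) ≤ ∑' n, θ ^ n := by
  calc ∑ j ∈ Finset.range p, θ ^ (p - j) = ∑ j ∈ Finset.range p, θ ^ (j + 1) := by
        rw [← Finset.sum_range_reflect]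
        refine Finset.sum_congr rfl fun j hj => ?_
        have := Finset.mem_range.1 hj
        congr 1
        lia
    _ ≤ ∑ j ∈ Finset.range p, θ ^ j :=
        Finset.sum_le_sum fun j _ => pow_le_pow_of_le_one zero_le hθ.le j.le_succ
    _ ≤ ∑' n, θ ^ n := (NNReal.summable_geometric hθ).sum_le_tsum _ fun _ _ => zero_le

theorem CondDec.exists_ebvNorm_pushSum_le (hDec : CondDec 𝒞) (h𝒞 : NonsingularClass 𝒞) :
    ∃ L : ℝ≥0, ∀ T : ℕ → I → I, (∀ n, 1 ≤ n → T n ∈ 𝒞) →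
      ∀ (f : ℕ → L1) (A : ℝ≥0), (∀ k, ∫ x, f k x = 0) → (∀ k, ebvNorm (f k) ≤ A) →
        ∀ p, ebvNorm (pushSum T f p) ≤ (L * A : ℝ≥0) := by
  obtain ⟨θ, K, hθ, hdec⟩ := hDec.exists_ebvNorm_applyOps_le
  refine ⟨K * ∑' n, θ ^ n, fun T hT f A hf0 hfA p => ?_⟩
  have hterm : ∀ j ∈ Finset.range p,
      ebvNorm (applyOps ((List.range' (j + 1) (p - j)).map fun i => transferOp (T i)) (f j))
        ≤ (K * θ ^ (p - j) * A : ℝ≥0) := by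
    intro j hj
    have hjp : 0 < p - j := Nat.sub_pos_of_lt (Finset.mem_range.1 hj)
    have hBV : IsBV (f j) := ebvNorm_ne_top_iff.1 (ne_top_of_le_ne_top ENNReal.coe_ne_top (hfA j))
    have := hdec ((List.range' (j + 1) (p - j)).map fun i => transferOp (T i))
      (by simpa using hjp.ne')
      (by
        simp only [List.mem_map, forall_exists_index, and_imp, forall_apply_eq_imp_iff₂]
        exact fun i hi => ⟨T i, hT i (by have := (List.mem_range'_1.1 hi).1; lia), rfl⟩)
      (f j) hBV (hf0 j)
    rw [List.length_map, List.length_range'] at this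
    rw [ENNReal.coe_mul]
    exact this.trans (mul_le_mul_right (hfA j) _)
  rw [pushSum_eq_sum fun n hn => h𝒞 _ (hT n hn)]
  refine ((ebvNorm_sum_le _ _).trans (Finset.sum_le_sum hterm)).trans ?_
  rw [← ENNReal.ofNNReal_finsetSum, ENNReal.coe_le_coe, ← Finset.sum_mul, ← Finset.mul_sum]
  gcongr
  exact sum_pow_sub_le_tsum hθ p

end PushedSums

section Densities

variable {𝒞 : Set (I → I)} {T : ℕ → I → I}

/-- The defect `P_{T_j} 𝟙 - 𝟙` of the invariance of Lebesgue measure under `T_j`. It is `0` at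
`j = 0`, since the sequence of maps starts with `T_1`. -/
def densityDefect (T : ℕ → I → I) : ℕ → L1
  | 0 => 0
  | j + 1 => density (T (j + 1)) - Lp.const 1 volume 1

theorem density_seqComp (hT : ∀ n, 1 ≤ n → Nonsingular (T n)) (k : ℕ) :
    density (seqComp T k) =
      Lp.const 1 volume 1 + (pushSum T (densityDefect T) k + densityDefect T k) := by
  induction k with
  | zero => rw [seqComp, density_id, pushSum, densityDefect, add_zero, add_zero]
  | succ k ih =>
    have hk := hT (k + 1) k.succ_pos
    rw [seqComp, density, transferOp_comp hk (nonsingular_seqComp hT k), ← density, ih,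
      transferOp_add hk, ← density, pushSum, densityDefect]
    abel

theorem integral_densityDefect (hT : ∀ n, 1 ≤ n → Nonsingular (T n)) (k : ℕ) :
    ∫ x, densityDefect T k x = 0 := by
  cases k with
  | zero => simp [densityDefect]
  | succ k =>
    rw [densityDefect, integral_congr_ae (Lp.coeFn_sub _ _), integral_sub'
      (L1.integrable_coeFn _) (L1.integrable_coeFn _), density,
      integral_transferOp (hT (k + 1) k.succ_pos), sub_self]

theorem ebvNorm_densityDefect_le {M : ℝ≥0} (hM : ∀ n, 1 ≤ n → ebvNorm (density (T n)) ≤ M)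
    (k : ℕ) : ebvNorm (densityDefect T k) ≤ (M + 1 : ℝ≥0) := by
  cases k with
  | zero => exact ebvNorm_zero.trans_le zero_le
  | succ k =>
    rw [densityDefect, sub_eq_add_neg, ← map_neg, ENNReal.coe_add]
    refine (ebvNorm_add_le _ _).trans (add_le_add (hM _ k.succ_pos) ?_)
    exact (ebvNorm_const_le (-1)).trans_eq (by rw [enorm_neg, enorm_one, ENNReal.coe_one])

theorem CondDec.exists_ebvNorm_density_seqComp_le (hDec : CondDec 𝒞) (h𝒞 : NonsingularClass 𝒞)
    {M : ℝ≥0} (hM : ∀ S ∈ 𝒞, ebvNorm (density S) ≤ M) :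
    ∃ B : ℝ≥0, ∀ T : ℕ → I → I, (∀ n, 1 ≤ n → T n ∈ 𝒞) →
      ∀ k, ebvNorm (density (seqComp T k)) ≤ B := by
  obtain ⟨L, hL⟩ := hDec.exists_ebvNorm_pushSum_le h𝒞
  refine ⟨1 + (L * (M + 1) + (M + 1)), fun T hT k => ?_⟩
  have hTn : ∀ n, 1 ≤ n → Nonsingular (T n) := fun n hn => h𝒞 _ (hT n hn)
  have hdefect := ebvNorm_densityDefect_le fun n hn => hM _ (hT n hn)
  rw [density_seqComp hTn, ENNReal.coe_add, ENNReal.coe_add]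
  refine (ebvNorm_add_le _ _).trans (add_le_add ((ebvNorm_const_le 1).trans_eq enorm_one)
    ((ebvNorm_add_le _ _).trans (add_le_add ?_ (hdefect k))))
  exact hL T hT _ _ (integral_densityDefect hTn) hdefect k

end Densities

section ReverseMartingale

variable {T : ℕ → I → I} {f : ℕ → L1} {δ A R : ℝ≥0}

theorem antitone_comap_seqComp (hT : ∀ n, 1 ≤ n → Measurable (T n)) :
    Antitone fun k => MeasurableSpace.comap (seqComp T k) inferInstance :=
  antitone_nat_of_succ_le fun k => by
    rw [seqComp, ← MeasurableSpace.comap_comp]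
    exact MeasurableSpace.comap_mono (hT (k + 1) k.succ_pos).comap_le

/-- The difference, at time `k`, of the reverse martingale which approximates the sums of
`densityRatio (T_1^k) (f_k)`. Up to null sets it is
`E(h_k | T_1^k) - E(h_k | T_1^{k+1})`, with `h_k` the sum of the first `k + 1` terms. -/
def martingaleDifference (T : ℕ → I → I) (f : ℕ → L1) (k : ℕ) : I → ℝ :=
  densityRatio (seqComp T k) (pushSum T f k + f k) -
    densityRatio (seqComp T (k + 1)) (pushSum T f (k + 1))

theorem measurable_martingaleDifference (hT : ∀ n, 1 ≤ n → Measurable (T n)) (k : ℕ) :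
    Measurable[MeasurableSpace.comap (seqComp T k) inferInstance] (martingaleDifference T f k) :=
  (measurable_densityRatio _ _).sub
    ((measurable_densityRatio _ _).mono (antitone_comap_seqComp hT k.le_succ) le_rfl)

theorem condExp_martingaleDifference (hT : ∀ n, 1 ≤ n → Nonsingular (T n))
    (hpos : ∀ k, ∀ᵐ x : I, density (seqComp T k) x ≠ 0) (k : ℕ) :
    volume[martingaleDifference T f k | MeasurableSpace.comap (seqComp T (k + 1)) inferInstance]
      =ᵐ[volume] 0 := by
  have hS := nonsingular_seqComp hT
  have hint (j : ℕ) (F : L1) := integrable_densityRatio (hS j) (hpos j) F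
  have hself := condExp_of_stronglyMeasurable (hS (k + 1)).measurable.comap_le
    (measurable_densityRatio (seqComp T (k + 1)) (pushSum T f (k + 1))).stronglyMeasurable
    (hint _ _)
  refine ((condExp_sub (hint _ _) (hint _ _) _).trans
    ((condExp_densityRatio (hS k) (hT (k + 1) k.succ_pos) (hpos k) (hpos (k + 1)) _).sub
      (.of_eq hself))).trans (.of_eq ?_)
  exact sub_self _

theorem abs_martingaleDifference_le (hT : ∀ n, 1 ≤ n → Nonsingular (T n)) (hδ : 0 < δ)
    (hdens : ∀ k, ∀ᵐ x : I, δ ≤ density (seqComp T k) x) (hA : ∀ k, ebvNorm (f k) ≤ A)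
    (hR : ∀ k, ebvNorm (pushSum T f k) ≤ R) (k : ℕ) :
    ∀ᵐ x : I, |martingaleDifference T f k x| ≤ ((A + 2 * R) / δ : ℝ≥0) := by
  have hS := nonsingular_seqComp hT
  have hsum : ebvNorm (pushSum T f k + f k) ≤ (R + A : ℝ≥0) := by
    rw [ENNReal.coe_add]
    exact (ebvNorm_add_le _ _).trans (add_le_add (hR k) (hA k))
  filter_upwards [abs_densityRatio_le (hS k) hδ (hdens k) hsum,
    abs_densityRatio_le (hS (k + 1)) hδ (hdens (k + 1)) (hR (k + 1))] with x h₁ h₂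
  calc |martingaleDifference T f k x| ≤ (R + A : ℝ≥0) / δ + R / δ :=
        (abs_sub _ _).trans (add_le_add h₁ h₂)
    _ = ((A + 2 * R) / δ : ℝ≥0) := by
        push_cast
        ring

theorem sum_densityRatio_ae_eq (hT : ∀ n, 1 ≤ n → Nonsingular (T n)) (n : ℕ) :
    ∑ k ∈ Finset.range n, densityRatio (seqComp T k) (f k) =ᵐ[volume]
      ∑ k ∈ Finset.range n, martingaleDifference T f k +
        densityRatio (seqComp T n) (pushSum T f n) := by
  induction n with
  | zero => exact .of_eq (by ext x; simp [densityRatio, seqComp, pushSum])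
  | succ n ih =>
    filter_upwards [ih, densityRatio_add (nonsingular_seqComp hT n) (pushSum T f n) (f n)]
      with x hx hadd
    simp only [Finset.sum_range_succ, Pi.add_apply, martingaleDifference, Pi.sub_apply]
      at hx hadd ⊢
    rw [hx, hadd]
    ring

theorem nnnorm_sub_neg_div_two (D : ℝ≥0) : ‖(D : ℝ) - -D‖₊ / 2 = D := by
  rw [sub_neg_eq_add, ← two_mul, nnnorm_mul, Real.nnnorm_two, NNReal.nnnorm_eq,
    mul_div_cancel_left₀ _ two_ne_zero]

theorem hasSubgaussianMGF_densityRatio {S : I → I} (hS : Nonsingular S) (hδ : 0 < δ)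
    (hdens : ∀ᵐ x : I, δ ≤ density S x) {F : L1} (hF : ebvNorm F ≤ R) (hF0 : ∫ x, F x = 0) :
    HasSubgaussianMGF (densityRatio S F) ((R / δ) ^ 2) volume := by
  have hb : ∀ᵐ x : I, |densityRatio S F x| ≤ (R / δ : ℝ≥0) := by
    exact_mod_cast abs_densityRatio_le hS hδ hdens hF
  have hmean : ∫ x, densityRatio S F x = 0 := by
    rw [← setIntegral_univ, ← Set.preimage_univ (f := S),
      setIntegral_densityRatio hS (ae_density_ne_zero hδ hdens) F .univ, setIntegral_univ, hF0]
  have := hasSubgaussianMGF_of_mem_Icc_of_integral_eq_zero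
    ((measurable_densityRatio S F).mono hS.measurable.comap_le le_rfl).aemeasurable
    (hb.mono fun x => abs_le.1) hmean
  rwa [nnnorm_sub_neg_div_two] at this

theorem hasCondSubgaussianMGF_martingaleDifference (hT : ∀ n, 1 ≤ n → Nonsingular (T n))
    (hδ : 0 < δ) (hdens : ∀ k, ∀ᵐ x : I, δ ≤ density (seqComp T k) x)
    (hA : ∀ k, ebvNorm (f k) ≤ A) (hR : ∀ k, ebvNorm (pushSum T f k) ≤ R) (k : ℕ) :
    HasCondSubgaussianMGF (MeasurableSpace.comap (seqComp T (k + 1)) inferInstance)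
      (nonsingular_seqComp hT (k + 1)).measurable.comap_le (martingaleDifference T f k)
      (((A + 2 * R) / δ) ^ 2) volume := by
  have hmeas := (measurable_martingaleDifference (f := f) (fun n hn => (hT n hn).measurable) k).mono
    (nonsingular_seqComp hT k).measurable.comap_le le_rfl
  have := hasCondSubgaussianMGF_of_mem_Icc_of_condExp_eq_zero
    (nonsingular_seqComp hT (k + 1)).measurable.comap_le hmeas.aemeasurable
    ((abs_martingaleDifference_le hT hδ hdens hA hR k).mono fun x => abs_le.1)
    (condExp_martingaleDifference hT (fun j => ae_density_ne_zero hδ (hdens j)) k)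
  rwa [nnnorm_sub_neg_div_two] at this

theorem hasSubgaussianMGF_sum_densityRatio (hT : ∀ n, 1 ≤ n → Nonsingular (T n)) (hδ : 0 < δ)
    (hdens : ∀ k, ∀ᵐ x : I, δ ≤ density (seqComp T k) x) (hf : ∀ k, ∫ x, f k x = 0)
    (hA : ∀ k, ebvNorm (f k) ≤ A) (hR : ∀ k, ebvNorm (pushSum T f k) ≤ R) (n : ℕ) :
    HasSubgaussianMGF (∑ k ∈ Finset.range n, densityRatio (seqComp T k) (f k))
      (n * ((A + 2 * R) / δ) ^ 2 + (R / δ) ^ 2) volume := by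
  have hTm : ∀ n, 1 ≤ n → Measurable (T n) := fun n hn => (hT n hn).measurable
  have hsum := hasSubgaussianMGF_sum_add_of_antitone (antitone_comap_seqComp hTm)
    (fun k => (nonsingular_seqComp hT k).measurable.comap_le) (measurable_martingaleDifference hTm)
    (hasCondSubgaussianMGF_martingaleDifference hT hδ hdens hA hR) n (measurable_densityRatio _ _)
    (hasSubgaussianMGF_densityRatio (nonsingular_seqComp hT n) hδ (hdens n) (hR n)
      (integral_pushSum hT hf n))
  rw [Finset.sum_const, Finset.card_range, nsmul_eq_mul] at hsum
  exact hsum.congr (sum_densityRatio_ae_eq hT n).symm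

end ReverseMartingale

section CentredIndicator

/-- The centred indicator function `𝟙_{[0,t]} - ν [0,t]` of a probability measure `ν`. -/
def centredIndicator (ν : Measure I) (t y : I) : ℝ :=
  (Set.Iic t).indicator 1 y - ν.real (Set.Iic t)

theorem measurable_uncurry_centredIndicator (ν : Measure I) [IsFiniteMeasure ν] :
    Measurable (Function.uncurry (centredIndicator ν)) := by
  have hind : Measurable ({p : I × I | p.2 ≤ p.1}.indicator (1 : I × I → ℝ)) :=
    measurable_one.indicator (measurableSet_le measurable_snd measurable_fst)
  have hcdf : Monotone fun t => ν.real (Set.Iic t) := fun s t hst =>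
    measureReal_mono (Set.Iic_subset_Iic.2 hst)
  exact hind.sub (hcdf.measurable.comp measurable_fst)

theorem indicator_Iic_mem_Icc (t y : I) : (Set.Iic t).indicator (1 : I → ℝ) y ∈ Set.Icc 0 1 :=
  ⟨Set.indicator_nonneg (fun _ _ => zero_le_one) y,
    Set.indicator_le_self' (fun _ _ => zero_le_one) y⟩

theorem antitone_centredIndicator (ν : Measure I) (t : I) : Antitone (centredIndicator ν t) := by
  intro x y hxy
  refine sub_le_sub_right (Set.indicator_apply_le' (fun hy => ?_) fun _ => ?_) _
  · exact (Set.indicator_of_mem (show x ∈ Set.Iic t from hxy.trans hy) (1 : I → ℝ)).ge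
  · exact (indicator_Iic_mem_Icc t x).1

theorem enorm_centredIndicator_le (ν : Measure I) [IsZeroOrProbabilityMeasure ν] (t y : I) :
    ‖centredIndicator ν t y‖ₑ ≤ (1 : ℝ≥0) := by
  have hind := indicator_Iic_mem_Icc t y
  exact enorm_le_coe.2
    (abs_sub_le_of_nonneg_of_le hind.1 hind.2 measureReal_nonneg measureReal_le_one)

theorem eVariationOn_centredIndicator_le (ν : Measure I) (t : I) :
    eVariationOn (centredIndicator ν t) Set.univ ≤ (1 : ℝ≥0) := by
  have hvar := eVariationOn_eq_of_antitoneOn ((antitone_centredIndicator ν t).antitoneOn Set.univ)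
    (Set.mem_univ ⊥) (Set.mem_univ ⊤)
  rw [Set.univ_inter, Set.Icc_bot_top] at hvar
  rw [hvar, centredIndicator, centredIndicator, sub_sub_sub_cancel_right, ENNReal.coe_one,
    ENNReal.ofReal_le_one]
  linarith [(indicator_Iic_mem_Icc t ⊥).2, (indicator_Iic_mem_Icc t ⊤).1]

theorem integrable_centredIndicator_mul_density (S : I → I) (t : I) :
    Integrable (centredIndicator (volume.map S) t * ⇑(density S)) :=
  (L1.integrable_coeFn (density S)).bdd_mul (c := 1)
    (measurable_uncurry_centredIndicator _).of_uncurry_left.aestronglyMeasurable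
    (.of_forall fun y => enorm_le_coe.1 (enorm_centredIndicator_le _ t y))

/-- The centred indicator of `[0,t]` times the density of `S_* m`, where it is centred for
`S_* m`, so that the product has integral zero. -/
def centredDensity (S : I → I) (t : I) : L1 :=
  (integrable_centredIndicator_mul_density S t).toL1 _

theorem coeFn_centredDensity (S : I → I) (t : I) :
    centredDensity S t =ᵐ[volume] centredIndicator (volume.map S) t * density S :=
  Integrable.coeFn_toL1 _

theorem integral_centredDensity {S : I → I} (hS : Nonsingular S) (t : I) :
    ∫ y, centredDensity S t y = 0 := by
  have hint := L1.integrable_coeFn (density S)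
  have hmul : centredIndicator (volume.map S) t * density S =
      (Set.Iic t).indicator (density S) -
        fun y => (volume.map S).real (Set.Iic t) * density S y := by
    ext y
    simp only [Pi.mul_apply, Pi.sub_apply, centredIndicator, sub_mul, ← Set.indicator_mul_left,
      Pi.one_apply, one_mul]
  have hone : ∫ y, density S y = 1 := by
    rw [density, integral_transferOp hS, integral_congr_ae (Lp.coeFn_const 1 volume 1)]
    simp
  rw [integral_congr_ae (coeFn_centredDensity S t), hmul,
    integral_sub' (hint.indicator measurableSet_Iic) (hint.const_mul _), integral_const_mul, hone,
    integral_indicator measurableSet_Iic, setIntegral_density hS measurableSet_Iic, mul_one,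
    sub_self]

theorem ebvNorm_centredDensity_le (S : I → I) (t : I) :
    ebvNorm (centredDensity S t) ≤ 2 * ebvNorm (density S) := by
  have := ebvNorm_le_mul_of_ae_eq_mul (enorm_centredIndicator_le (volume.map S) t)
    (eVariationOn_centredIndicator_le _ t) (coeFn_centredDensity S t)
  rwa [one_add_one_eq_two] at this

theorem densityRatio_centredDensity {S : I → I} (hS : Nonsingular S)
    (hpos : ∀ᵐ x : I, density S x ≠ 0) (t : I) :
    densityRatio S (centredDensity S t) =ᵐ[volume]
      fun x => centredIndicator (volume.map S) t (S x) := by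
  filter_upwards [hS.ae (coeFn_centredDensity S t), hS.ae hpos] with x hx hx0
  rw [densityRatio, hx, Pi.mul_apply, mul_div_cancel_right₀ _ hx0]

end CentredIndicator

section Concentration

variable {𝒞 : Set (I → I)} {T : ℕ → I → I}

theorem mul_kantorovich_eq (T : ℕ → I → I) {n : ℕ} (hn : 1 ≤ n) (x : I) :
    n * kantorovich (empiricalMeasure T n x) (meanMeasure T n) =
      ∫ t, |∑ k ∈ Finset.range n,
        centredIndicator (volume.map (seqComp T k)) t (seqComp T k x)| := by
  have hn0 : (n : ℝ) ≠ 0 := Nat.cast_ne_zero.2 (Nat.one_le_iff_ne_zero.1 hn)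
  have hdirac (k : ℕ) (t : I) : (Measure.dirac (seqComp T k x)).real (Set.Iic t) =
      (Set.Iic t).indicator 1 (seqComp T k x) := by
    rw [← integral_indicator_one measurableSet_Iic, integral_dirac]
  have hsum (μ : ℕ → Measure I) [∀ k, IsFiniteMeasure (μ k)] (t : I) :
      ((n : ℝ≥0∞)⁻¹ • ∑ k ∈ Finset.range n, μ k).real (Set.Iic t) =
        (n : ℝ)⁻¹ * ∑ k ∈ Finset.range n, (μ k).real (Set.Iic t) := by
    rw [measureReal_ennreal_smul_apply, ENNReal.toReal_inv, ENNReal.toReal_natCast, measureReal_def,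
      Measure.finsetSum_apply, ENNReal.toReal_sum fun _ _ => measure_ne_top _ _]
    rfl
  rw [kantorovich, ← integral_const_mul]
  congr with t
  rw [empiricalMeasure, meanMeasure, hsum, hsum, ← mul_sub, abs_mul, abs_inv, Nat.abs_cast,
    mul_inv_cancel_left₀ hn0, ← Finset.sum_sub_distrib]
  simp only [hdirac, centredIndicator]

theorem measureReal_kantorovich_gt_le (hS : ∀ k, Measurable (seqComp T k)) {n : ℕ} (hn : 1 ≤ n)
    {c : ℝ≥0} (hsub : ∀ s, HasSubgaussianMGF (fun x => ∑ k ∈ Finset.range n,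
      centredIndicator (volume.map (seqComp T k)) s (seqComp T k x)) (n * c) volume)
    {t : ℝ} (ht : 0 ≤ t) :
    (volume : Measure I).real
        {x | t / √n < kantorovich (empiricalMeasure T n x) (meanMeasure T n)} ≤
      2 * Real.exp (-t ^ 2 / (2 * c)) := by
  have hn0 : (0 : ℝ) < n := Nat.cast_pos.2 hn
  have hmeas : Measurable (Function.uncurry fun x s => ∑ k ∈ Finset.range n,
      centredIndicator (volume.map (seqComp T k)) s (seqComp T k x)) :=
    Finset.measurable_fun_sum _ fun k _ => (measurable_uncurry_centredIndicator _).comp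
      (measurable_snd.prodMk ((hS k).comp measurable_fst))
  refine (measureReal_mono fun x hx => ?_).trans
    ((measureReal_ge_integral_abs_le (ν := volume) hmeas hsub (ε := t * √n)
      (by positivity)).trans_eq ?_)
  · rw [Set.mem_ofPred_eq, ← mul_kantorovich_eq T hn]
    calc t * √n = n * (t / √n) := by
          rw [mul_div_left_comm, Real.div_sqrt]
      _ ≤ n * kantorovich (empiricalMeasure T n x) (meanMeasure T n) :=
          mul_le_mul_of_nonneg_left (le_of_lt hx) hn0.le
  · rw [mul_pow, Real.sq_sqrt hn0.le, NNReal.coe_mul, NNReal.coe_natCast, mul_left_comm 2,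
      mul_comm (t ^ 2), ← mul_neg, mul_div_mul_left _ _ hn0.ne']

theorem CondMin.exists_le_density (hMin : CondMin T) :
    ∃ δ : ℝ≥0, 0 < δ ∧ ∀ k, ∀ᵐ x : I, δ ≤ density (seqComp T k) x := by
  obtain ⟨δ, hδ, h⟩ := hMin
  refine ⟨min δ.toNNReal 1, lt_min (Real.toNNReal_pos.2 hδ) one_pos, fun k => ?_⟩
  rw [NNReal.coe_min, Real.coe_toNNReal _ hδ.le, NNReal.coe_one]
  cases k with
  | zero =>
    filter_upwards [Lp.coeFn_const 1 (volume : Measure I) (1 : ℝ)] with x hx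
    rw [seqComp, density_id, hx]
    exact min_le_right _ _
  | succ k => exact (h (k + 1) k.succ_pos).mono fun x hx => (min_le_left _ _).trans hx

theorem CondDec.exists_hasSubgaussianMGF_sum_centredIndicator (hDec : CondDec 𝒞)
    (h𝒞 : NonsingularClass 𝒞) {M : ℝ≥0} (hM : ∀ S ∈ 𝒞, ebvNorm (density S) ≤ M)
    (hT : ∀ n, 1 ≤ n → T n ∈ 𝒞) (hMin : CondMin T) :
    ∃ c : ℝ≥0, 0 < c ∧ ∀ n, 1 ≤ n → ∀ t, HasSubgaussianMGF (fun x => ∑ k ∈ Finset.range n,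
      centredIndicator (volume.map (seqComp T k)) t (seqComp T k x)) (n * c) volume := by
  have hTn : ∀ n, 1 ≤ n → Nonsingular (T n) := fun n hn => h𝒞 _ (hT n hn)
  have hS := nonsingular_seqComp hTn
  obtain ⟨δ, hδ, hdens⟩ := hMin.exists_le_density
  obtain ⟨B, hB⟩ := hDec.exists_ebvNorm_density_seqComp_le h𝒞 hM
  obtain ⟨L, hL⟩ := hDec.exists_ebvNorm_pushSum_le h𝒞
  have hA (t : I) (k : ℕ) : ebvNorm (centredDensity (seqComp T k) t) ≤ (2 * B : ℝ≥0) :=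
    (ebvNorm_centredDensity_le _ t).trans (mul_le_mul_right (hB T hT k) 2)
  refine ⟨((2 * B + 2 * (L * (2 * B))) / δ) ^ 2 + (L * (2 * B) / δ) ^ 2 + 1, by positivity,
    fun n hn t => ?_⟩
  have h0 (k : ℕ) := integral_centredDensity (hS k) t
  have hsum := hasSubgaussianMGF_sum_densityRatio hTn hδ hdens h0 (hA t) (hL T hT _ _ h0 (hA t)) n
  have hae : ∑ k ∈ Finset.range n, densityRatio (seqComp T k) (centredDensity (seqComp T k) t)
      =ᵐ[volume] fun x => ∑ k ∈ Finset.range n,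
        centredIndicator (volume.map (seqComp T k)) t (seqComp T k x) := by
    filter_upwards [ae_all_iff.2 fun k => densityRatio_centredDensity (hS k)
      (ae_density_ne_zero hδ (hdens k)) t] with x hx
    simp only [Finset.sum_apply, hx]
  refine hasSubgaussianMGF_mono (hsum.congr hae) ?_
  rw [add_assoc, mul_add]
  gcongr
  exact (le_add_of_nonneg_right zero_le).trans
    (le_mul_of_one_le_left zero_le (by exact_mod_cast hn))

theorem CondD.exists_bvNorm_transferOp_one_le {r : ℕ} (hD : CondD r 𝒞) :
    ∃ M : ℝ, ∀ S ∈ 𝒞, IsBV (transferOp S (Lp.const 1 (volume : Measure I) (1 : ℝ))) ∧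
      bvNorm (transferOp S (Lp.const 1 (volume : Measure I) (1 : ℝ))) ≤ M := by
  obtain ⟨-, hinv, -, M₀, -, -, -, -, -, hM₀, -⟩ := hD
  have hone : IsBV (Lp.const 1 (volume : Measure I) (1 : ℝ)) :=
    ebvNorm_ne_top_iff.1 (ne_top_of_le_ne_top enorm_ne_top (ebvNorm_const_le 1))
  exact ⟨_, fun S hS => ⟨hinv _ ⟨S, hS, rfl⟩ _ hone, hM₀ _ ⟨S, hS, rfl⟩ _ hone⟩⟩

end Concentration

end

end SeqDyn

theorem mainTheorem8_general
    (𝒞 : Set (unitInterval → unitInterval)) (h𝒞 : SeqDyn.NonsingularClass 𝒞)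
    (hOne : ∃ M : ℝ, ∀ S ∈ 𝒞,
      SeqDyn.IsBV (SeqDyn.transferOp S (Lp.const 1 (volume : Measure unitInterval) (1 : ℝ))) ∧
      SeqDyn.bvNorm (SeqDyn.transferOp S (Lp.const 1 (volume : Measure unitInterval) (1 : ℝ))) ≤ M)
    (hDec : SeqDyn.CondDec 𝒞)
    (T : ℕ → unitInterval → unitInterval) (hT : ∀ n : ℕ, 1 ≤ n → T n ∈ 𝒞)
    (hMin : SeqDyn.CondMin T) :
    ∃ C : ℝ, 0 < C ∧ ∀ t : ℝ, 0 < t → ∀ n : ℕ, 1 ≤ n →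
      (volume : Measure unitInterval).real
          {x | SeqDyn.kantorovich (SeqDyn.empiricalMeasure T n x) (SeqDyn.meanMeasure T n)
            > t / Real.sqrt n}
        ≤ 2 * Real.exp (-(C * t ^ 2)) := by
  obtain ⟨M, hM⟩ := hOne
  have hdensity : ∀ S ∈ 𝒞, SeqDyn.ebvNorm (SeqDyn.density S) ≤ M.toNNReal := fun S hS =>
    (hM S hS).1.ofReal_bvNorm.symm.trans_le (ENNReal.ofReal_le_ofReal (hM S hS).2)
  obtain ⟨c, hc, hsub⟩ := hDec.exists_hasSubgaussianMGF_sum_centredIndicator h𝒞 hdensity hT hMin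
  have hS (k : ℕ) := (SeqDyn.nonsingular_seqComp (fun n hn => h𝒞 _ (hT n hn)) k).measurable
  refine ⟨1 / (2 * c), by positivity, fun t ht n hn => ?_⟩
  refine (SeqDyn.measureReal_kantorovich_gt_le hS hn (hsub n hn) ht.le).trans_eq ?_
  rw [neg_div, div_eq_mul_one_div, mul_comm (t ^ 2)]

theorem mainTheorem8
    (𝒞 : Set (unitInterval → unitInterval)) (h𝒞 : SeqDyn.NonsingularClass 𝒞)
    (r : ℕ) (hD : SeqDyn.CondD r 𝒞) (hDec : SeqDyn.CondDec 𝒞)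
    (T : ℕ → unitInterval → unitInterval) (hT : ∀ n : ℕ, 1 ≤ n → T n ∈ 𝒞)
    (hMin : SeqDyn.CondMin T) :
    ∃ C : ℝ, 0 < C ∧ ∀ t : ℝ, 0 < t → ∀ n : ℕ, 1 ≤ n →
      (volume : Measure unitInterval).real
          {x | SeqDyn.kantorovich (SeqDyn.empiricalMeasure T n x) (SeqDyn.meanMeasure T n)
            > t / Real.sqrt n}
        ≤ 2 * Real.exp (-(C * t ^ 2)) :=
  mainTheorem8_general 𝒞 h𝒞 hD.exists_bvNorm_transferOp_one_le hDec T hT hMin
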